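/- Let $k$ be a field and let $m,n$ be integers with $1\le n\le m$. Let $K_{m,n}$ be the complete bipartite graph with parts $\{x_1,\dots,x_m\}$ and $\{y_1,\dots,y_n\}$, let $R=k[x_1,\dots,x_m,y_1,\dots,y_n]$, and let $I=I(K_{m,n})=(x_iy_j : 1\le i\le m,\ 1\le j\le n)$ be its edge ideal. The graph $K_{m,n}$ is called almost Cohen–Macaulay (over $k$) if $\operatorname{depth} R/I\ \ge\ \dim R/I-1$, where $\dim$ is the Krull dimension and $\operatorname{depth} R/I$ is the supremum of the lengths of the $R/I$-regular sequences contained in the graded maximal ideal $(x_1,\dots,x_m,y_1,\dots,y_n)$ of $R$. Then $K_{m,n}$ is almost Cohen–Macaulay if and only if $n\le m\le 2$. -/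

import Mathlib

/-- The edge ideal of a simple graph `G` in the polynomial ring over `k` whose variables are the
vertices of `G`: it is generated by the monomials `x_u x_v` for `u` adjacent to `v`. -/
noncomputable def SimpleGraph.edgeIdeal (k : Type*) [Field k] {V : Type*} (G : SimpleGraph V) :
    Ideal (MvPolynomial V k) :=
  Ideal.span {f | ∃ u v, G.Adj u v ∧ f = MvPolynomial.X u * MvPolynomial.X v}

/-- The depth (grade) of an ideal `J` on a module `M`: the supremum of the lengths of the
`M`-regular sequences contained in `J`. -/
noncomputable def Ideal.moduleDepth {R : Type*} [CommRing R] (J : Ideal R)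
    (M : Type*) [AddCommGroup M] [Module R M] : ℕ∞ :=
  ⨆ (rs : List R) (_ : RingTheory.Sequence.IsRegular M rs ∧ ∀ r ∈ rs, r ∈ J), (rs.length : ℕ∞)

/-- A graph `G` is almost Cohen–Macaulay over `k` if `depth R/I(G) ≥ dim R/I(G) - 1`, where `R` is
the polynomial ring on the vertices. The depth is taken with respect to the graded maximal ideal
of `R`, which is generated by the variables, and the dimension is the Krull dimension. The
inequality is written additively to avoid a subtraction. -/
def SimpleGraph.IsAlmostCohenMacaulay (k : Type*) [Field k] {V : Type*} (G : SimpleGraph V) :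
    Prop :=
  ringKrullDim (MvPolynomial V k ⧸ G.edgeIdeal k) ≤
    (((MvPolynomial.idealOfVars V k).moduleDepth (MvPolynomial V k ⧸ G.edgeIdeal k) : ℕ∞) :
      WithBot ℕ∞) + 1

/-!
For nonempty finite types `V` and `W` put `R = k[V ⊕ W]`, and let `Q` and `P` be the ideals
generated by the variables in `W` and in `V` respectively. They are the kernels of the
projections of `R` onto `k[V]` and onto `k[W]`, so both are prime, and a comparison of monomials
shows that the edge ideal of the complete bipartite graph is `P ⊓ Q`
(`edgeIdeal_completeBipartiteGraph`). Every prime containing `P ⊓ Q` contains `P` or `Q`, hence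
the quotient has dimension `max |V| |W|` (`ringKrullDim_quotient_inf`).

Its depth with respect to the graded maximal ideal `P ⊔ Q` is always `1`
(`moduleDepth_sup_quotient_inf`): geometrically, two linear subspaces that meet only in the origin
are disconnected by removing that point. Algebraically, let `f = a + b` with `a ∈ P` and `b ∈ Q`
be a nonzerodivisor on `R ⧸ P ⊓ Q`. Multiplication by `P ⊔ Q` sends `a` into `f (R ⧸ P ⊓ Q)`,
while `a` itself does not lie there, so no regular sequence in `P ⊔ Q` continues past `f`.

For `n ≤ m` the almost Cohen–Macaulay inequality for `K_{m,n}` therefore reads `m ≤ 1 + 1`.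
-/

open RingTheory.Sequence

/-! ### Dimension and depth modulo the intersection of two ideals -/

section CommRing

variable {R : Type*} [CommRing R] {P Q : Ideal R}

lemma ringKrullDim_quotient_inf (P Q : Ideal R) :
    ringKrullDim (R ⧸ P ⊓ Q) = max (ringKrullDim (R ⧸ P)) (ringKrullDim (R ⧸ Q)) := by
  apply le_antisymm
  · rw [ringKrullDim_quotient (P ⊓ Q), Order.krullDim]
    refine iSup_le fun s ↦ ?_
    -- Every term of a chain contains its smallest one, so a chain lies over `P` or over `Q`.
    have lift (J : Ideal R) (hJ : J ≤ s.head.1.asIdeal) :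
        (s.length : WithBot ℕ∞) ≤ ringKrullDim (R ⧸ J) := by
      rw [ringKrullDim_quotient]
      let t : LTSeries (PrimeSpectrum.zeroLocus (R := R) J) :=
        { length := s.length
          toFun := fun i ↦ ⟨(s i).1, hJ.trans (s.head_le i)⟩
          step := s.step }
      exact Order.LTSeries.length_le_krullDim t
    have hs : P ⊓ Q ≤ s.head.1.asIdeal := s.head.2
    rcases s.head.1.isPrime.inf_le.mp hs with h | h
    · exact (lift P h).trans (le_max_left _ _)
    · exact (lift Q h).trans (le_max_right _ _)
  · exact max_le
      (ringKrullDim_le_of_surjective _ (Ideal.Quotient.factor_surjective inf_le_left))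
      (ringKrullDim_le_of_surjective _ (Ideal.Quotient.factor_surjective inf_le_right))

lemma isSMulRegular_quotient_inf [P.IsPrime] [Q.IsPrime] {f : R} (hP : f ∉ P) (hQ : f ∉ Q) :
    IsSMulRegular (R ⧸ P ⊓ Q) f := by
  refine (isSMulRegular_quotient_iff_mem_of_smul_mem _ f).mpr fun x hx ↦ ?_
  exact ⟨(Ideal.IsPrime.mem_or_mem ‹_› hx.1).resolve_left hP,
    (Ideal.IsPrime.mem_or_mem ‹_› hx.2).resolve_left hQ⟩

lemma isRegular_singleton_quotient {I J : Ideal R} (hIJ : I ≤ J) (hJ : J ≠ ⊤) {f : R}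
    (hf : f ∈ J) (hreg : IsSMulRegular (R ⧸ I) f) : IsRegular (R ⧸ I) [f] := by
  refine ⟨(isWeaklyRegular_singleton_iff _ f).mpr hreg, fun h ↦ hJ ?_⟩
  have h1 : (Ideal.Quotient.mk I 1) ∈ (⊤ : Submodule R (R ⧸ I)) := trivial
  rw [h, Ideal.ofList_singleton, Submodule.ideal_span_singleton_smul,
    Submodule.mem_smul_pointwise_iff_exists] at h1
  obtain ⟨y, -, hy⟩ := h1
  obtain ⟨c, rfl⟩ := Ideal.Quotient.mk_surjective y
  have h2 : f * c - 1 ∈ I := Ideal.Quotient.eq.mp hy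
  rw [Ideal.eq_top_iff_one]
  have := J.sub_mem (J.mul_mem_right c hf) (hIJ h2)
  rwa [sub_sub_cancel] at this

/-- If `f = a + b` is a nonzerodivisor modulo `P ⊓ Q`, with `a ∈ P` and `b ∈ Q`, then the class of
`a` is a nonzero element of `R ⧸ (P ⊓ Q + (f))` annihilated by `P ⊔ Q`. -/
lemma not_isSMulRegular_quotSMulTop_quotient_inf [P.IsPrime] [Q.IsPrime]
    (hPQ : ¬ P ≤ Q) (hQP : ¬ Q ≤ P) (htop : P ⊔ Q ≠ ⊤) {f g : R} (hf : f ∈ P ⊔ Q)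
    (hg : g ∈ P ⊔ Q) (hreg : IsSMulRegular (R ⧸ P ⊓ Q) f) :
    ¬ IsSMulRegular (QuotSMulTop f (R ⧸ P ⊓ Q)) g := by
  intro hgreg
  obtain ⟨a, ha, b, hb, rfl⟩ := Submodule.mem_sup.mp hf
  obtain ⟨p, hp, q, hq, rfl⟩ := Submodule.mem_sup.mp hg
  have hreg' := (isSMulRegular_quotient_iff_mem_of_smul_mem _ (a + b)).mp hreg
  have haQ : a ∉ Q := by
    intro haQ
    obtain ⟨x, hxP, hxQ⟩ := SetLike.not_le_iff_exists.mp hPQ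
    refine hxQ (hreg' x ⟨P.mul_mem_left _ hxP, Q.mul_mem_right _ (Q.add_mem haQ hb)⟩).2
  have hbP : b ∉ P := by
    intro hbP
    obtain ⟨x, hxQ, hxP⟩ := SetLike.not_le_iff_exists.mp hQP
    refine hxP (hreg' x ⟨P.mul_mem_right _ (P.add_mem ha hbP), Q.mul_mem_left _ hxQ⟩).1
  have hmem := (isSMulRegular_quotient_iff_mem_of_smul_mem _ (p + q)).mp hgreg
    (Ideal.Quotient.mk (P ⊓ Q) a) <| by
      rw [Submodule.mem_smul_pointwise_iff_exists]
      -- Modulo `P ⊓ Q` both `q * a` and `p * b` vanish, so `(p + q) * a = p * a = (a + b) * p`.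
      refine ⟨Ideal.Quotient.mk (P ⊓ Q) p, trivial, Ideal.Quotient.eq.mpr ?_⟩
      have : (a + b) • p - (p + q) • a = p * b - a * q := by simp only [smul_eq_mul]; ring
      rw [this]
      exact ⟨P.sub_mem (P.mul_mem_right _ hp) (P.mul_mem_right _ ha),
        Q.sub_mem (Q.mul_mem_left _ hb) (Q.mul_mem_left _ hq)⟩
  rw [Submodule.mem_smul_pointwise_iff_exists] at hmem
  obtain ⟨y, -, hy⟩ := hmem
  obtain ⟨h, rfl⟩ := Ideal.Quotient.mk_surjective y
  have hsub : (a + b) * h - a ∈ P ⊓ Q := Ideal.Quotient.eq.mp hy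
  have hhP : h ∈ P := by
    have : b * h ∈ P := by
      convert P.add_mem hsub.1 (P.mul_mem_right (1 - h) ha) using 1; ring
    exact (Ideal.IsPrime.mem_or_mem ‹_› this).resolve_left hbP
  have hhQ : 1 - h ∈ Q := by
    have : a * (1 - h) ∈ Q := by
      convert Q.sub_mem (Q.mul_mem_right h hb) hsub.2 using 1; ring
    exact (Ideal.IsPrime.mem_or_mem ‹_› this).resolve_left haQ
  refine htop ((Ideal.eq_top_iff_one _).mpr ?_)
  rw [← add_sub_cancel h 1]
  exact Submodule.add_mem_sup hhP hhQ

theorem moduleDepth_sup_quotient_inf [P.IsPrime] [Q.IsPrime]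
    (hPQ : ¬ P ≤ Q) (hQP : ¬ Q ≤ P) (htop : P ⊔ Q ≠ ⊤) :
    (P ⊔ Q).moduleDepth (R ⧸ P ⊓ Q) = 1 := by
  apply le_antisymm
  · refine iSup₂_le fun rs ⟨hrs, hmem⟩ ↦ ?_
    match rs with
    | [] => simp
    | [f] => simp
    | f :: g :: rs =>
      rw [isRegular_cons_iff, isRegular_cons_iff] at hrs
      exact absurd hrs.2.1 (not_isSMulRegular_quotSMulTop_quotient_inf hPQ hQP htop
        (hmem f (by simp)) (hmem g (by simp)) hrs.1)
  · obtain ⟨p, hpP, hpQ⟩ := SetLike.not_le_iff_exists.mp hPQ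
    obtain ⟨q, hqQ, hqP⟩ := SetLike.not_le_iff_exists.mp hQP
    have hf : p + q ∈ P ⊔ Q := Submodule.add_mem_sup hpP hqQ
    have hreg : IsSMulRegular (R ⧸ P ⊓ Q) (p + q) := isSMulRegular_quotient_inf
      (fun h ↦ hqP ((P.add_mem_iff_right hpP).mp h)) (fun h ↦ hpQ ((Q.add_mem_iff_left hqQ).mp h))
    refine le_iSup₂_of_le [p + q]
      ⟨isRegular_singleton_quotient (inf_le_left.trans le_sup_left) htop hf hreg, ?_⟩ (by simp)
    simpa using hf

end CommRing

/-! ### Ideals generated by variables -/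

namespace MvPolynomial

lemma ker_killCompl {σ τ A : Type*} [CommRing A] {f : σ → τ} (hf : Function.Injective f) :
    RingHom.ker (killCompl hf : MvPolynomial τ A →ₐ[A] MvPolynomial σ A) =
      Ideal.span (X '' (Set.range f)ᶜ) := by
  apply le_antisymm
  · intro p hp
    -- Modulo the variables outside the range of `f`, `rename f ∘ killCompl hf` is the identity.
    have key : ((Ideal.Quotient.mkₐ A (Ideal.span (X '' (Set.range f)ᶜ))).comp
        ((rename f).comp (killCompl hf))) = Ideal.Quotient.mkₐ A _ := by
      ext t
      by_cases ht : t ∈ Set.range f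
      · obtain ⟨s, rfl⟩ := ht
        simp only [AlgHom.comp_apply]
        rw [← rename_X, killCompl_rename_app]
      · have hmem : (X t : MvPolynomial τ A) ∈ Ideal.span (X '' (Set.range f)ᶜ) :=
          Ideal.subset_span ⟨t, ht, rfl⟩
        simpa [killCompl, aeval_X, dif_neg ht] using (Ideal.Quotient.eq_zero_iff_mem.mpr hmem).symm
    have := DFunLike.congr_fun key p
    rw [AlgHom.comp_apply, AlgHom.comp_apply, (RingHom.mem_ker).mp hp, map_zero, map_zero] at this
    exact Ideal.Quotient.eq_zero_iff_mem.mp this.symm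
  · rw [Ideal.span_le]
    rintro _ ⟨t, ht, rfl⟩
    have ht' : ¬ ∃ y, f y = t := ht
    simp [RingHom.mem_ker, killCompl, ht']

lemma ringKrullDim_quotient_ker_killCompl {σ τ k : Type*} [Finite σ] [Field k] {f : σ → τ}
    (hf : Function.Injective f) :
    ringKrullDim (MvPolynomial τ k ⧸
      RingHom.ker (killCompl hf : MvPolynomial τ k →ₐ[k] MvPolynomial σ k)) = Nat.card σ := by
  have hsurj : Function.Surjective (killCompl hf : MvPolynomial τ k →ₐ[k] MvPolynomial σ k) :=
    fun p ↦ ⟨rename f p, killCompl_rename_app hf p⟩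
  rw [ringKrullDim_eq_of_ringEquiv (Ideal.quotientKerAlgEquivOfSurjective hsurj).toRingEquiv,
    ringKrullDim_of_isNoetherianRing, ringKrullDim_eq_zero_of_field, zero_add]

lemma ker_killCompl_inl (k V W : Type*) [CommRing k] :
    RingHom.ker (killCompl Sum.inl_injective : MvPolynomial (V ⊕ W) k →ₐ[k] MvPolynomial V k) =
      Ideal.span (X '' Set.range Sum.inr) := by
  rw [ker_killCompl, Set.compl_range_inl]

lemma ker_killCompl_inr (k V W : Type*) [CommRing k] :
    RingHom.ker (killCompl Sum.inr_injective : MvPolynomial (V ⊕ W) k →ₐ[k] MvPolynomial W k) =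
      Ideal.span (X '' Set.range Sum.inl) := by
  rw [ker_killCompl, Set.compl_range_inr]

lemma span_X_image_ne_top {σ k : Type*} [CommRing k] [Nontrivial k] (s : Set σ) :
    Ideal.span (X '' s : Set (MvPolynomial σ k)) ≠ ⊤ := by
  rw [Ne, Ideal.eq_top_iff_one, mem_ideal_span_X_image]
  intro h
  obtain ⟨i, -, hi⟩ := h 0 (by simp)
  exact hi rfl

lemma X_mem_span_X_image {σ k : Type*} [CommRing k] [Nontrivial k] {s : Set σ} {i : σ} :
    (X i : MvPolynomial σ k) ∈ Ideal.span (X '' s : Set (MvPolynomial σ k)) ↔ i ∈ s := by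
  classical
  simp [mem_ideal_span_X_image, support_X, Finsupp.single_apply]

end MvPolynomial

/-! ### The edge ideal of a complete bipartite graph -/

open MvPolynomial

lemma edgeIdeal_completeBipartiteGraph (k V W : Type*) [Field k] :
    (completeBipartiteGraph V W).edgeIdeal k =
      Ideal.span (X '' Set.range Sum.inl) ⊓ Ideal.span (X '' Set.range Sum.inr) := by
  apply le_antisymm
  · rw [SimpleGraph.edgeIdeal, Ideal.span_le]
    have hl (v : V) : (X (Sum.inl v) : MvPolynomial (V ⊕ W) k) ∈
        Ideal.span (X '' Set.range Sum.inl) := Ideal.subset_span ⟨_, ⟨v, rfl⟩, rfl⟩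
    have hr (w : W) : (X (Sum.inr w) : MvPolynomial (V ⊕ W) k) ∈
        Ideal.span (X '' Set.range Sum.inr) := Ideal.subset_span ⟨_, ⟨w, rfl⟩, rfl⟩
    rintro _ ⟨v | v, w | w, hvw, rfl⟩
    · simp at hvw
    · exact ⟨Ideal.mul_mem_right _ _ (hl v), Ideal.mul_mem_left _ _ (hr w)⟩
    · exact ⟨Ideal.mul_mem_left _ _ (hl w), Ideal.mul_mem_right _ _ (hr v)⟩
    · simp at hvw
  · rintro p ⟨hl, hr⟩
    replace hl := mem_ideal_span_X_image.mp hl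
    replace hr := mem_ideal_span_X_image.mp hr
    let s : Set (V ⊕ W →₀ ℕ) :=
      {e | ∃ v w, e = Finsupp.single (Sum.inl v) 1 + Finsupp.single (Sum.inr w) 1}
    have hp : p ∈ Ideal.span ((fun e ↦ monomial e (1 : k)) '' s) := by
      classical
      refine mem_ideal_span_monomial_image.mpr fun e he ↦ ?_
      obtain ⟨_, ⟨v, rfl⟩, hv⟩ := hl e he
      obtain ⟨_, ⟨w, rfl⟩, hw⟩ := hr e he
      refine ⟨_, ⟨v, w, rfl⟩, fun i ↦ ?_⟩
      rcases i with i | i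
      · by_cases h : v = i
        · subst h; simpa [Nat.one_le_iff_ne_zero] using hv
        · simp [h]
      · by_cases h : w = i
        · subst h; simpa [Nat.one_le_iff_ne_zero] using hw
        · simp [h]
    refine Ideal.span_mono ?_ hp
    rintro _ ⟨_, ⟨v, w, rfl⟩, rfl⟩
    exact ⟨Sum.inl v, Sum.inr w, by simp, by simp [X, monomial_mul]⟩

lemma ringKrullDim_quotient_edgeIdeal_completeBipartiteGraph (k V W : Type*) [Field k]
    [Finite V] [Finite W] :
    ringKrullDim (MvPolynomial (V ⊕ W) k ⧸ (completeBipartiteGraph V W).edgeIdeal k) =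
      max (Nat.card V : WithBot ℕ∞) (Nat.card W) := by
  rw [edgeIdeal_completeBipartiteGraph, ringKrullDim_quotient_inf, ← ker_killCompl_inl,
    ← ker_killCompl_inr, ringKrullDim_quotient_ker_killCompl,
    ringKrullDim_quotient_ker_killCompl, max_comm]

lemma moduleDepth_quotient_edgeIdeal_completeBipartiteGraph (k V W : Type*) [Field k]
    [Nonempty V] [Nonempty W] :
    (idealOfVars (V ⊕ W) k).moduleDepth
      (MvPolynomial (V ⊕ W) k ⧸ (completeBipartiteGraph V W).edgeIdeal k) = 1 := by
  obtain ⟨v⟩ := ‹Nonempty V›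
  obtain ⟨w⟩ := ‹Nonempty W›
  have hsup : idealOfVars (V ⊕ W) k =
      Ideal.span (X '' Set.range Sum.inl) ⊔ Ideal.span (X '' Set.range Sum.inr) := by
    rw [idealOfVars, ← Ideal.span_union, ← Set.image_union, Set.range_inl_union_range_inr,
      Set.image_univ]
  have htop : idealOfVars (V ⊕ W) k ≠ ⊤ := by
    rw [idealOfVars, ← Set.image_univ]
    exact span_X_image_ne_top _
  have : (Ideal.span (X '' Set.range Sum.inl) : Ideal (MvPolynomial (V ⊕ W) k)).IsPrime := by
    rw [← ker_killCompl_inr]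
    exact RingHom.ker_isPrime _
  have : (Ideal.span (X '' Set.range Sum.inr) : Ideal (MvPolynomial (V ⊕ W) k)).IsPrime := by
    rw [← ker_killCompl_inl]
    exact RingHom.ker_isPrime _
  rw [edgeIdeal_completeBipartiteGraph, hsup]
  refine moduleDepth_sup_quotient_inf (fun h ↦ ?_) (fun h ↦ ?_) (hsup ▸ htop)
  · simpa using X_mem_span_X_image.mp (h (X_mem_span_X_image.mpr ⟨v, rfl⟩))
  · simpa using X_mem_span_X_image.mp (h (X_mem_span_X_image.mpr ⟨w, rfl⟩))

theorem mainTheorem9 (k : Type*) [Field k] (m n : ℕ) (hn : 1 ≤ n) (hnm : n ≤ m) :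
    (completeBipartiteGraph (Fin m) (Fin n)).IsAlmostCohenMacaulay k ↔ n ≤ m ∧ m ≤ 2 := by
  have : Nonempty (Fin n) := ⟨⟨0, hn⟩⟩
  have : Nonempty (Fin m) := ⟨⟨0, hn.trans hnm⟩⟩
  rw [SimpleGraph.IsAlmostCohenMacaulay,
    ringKrullDim_quotient_edgeIdeal_completeBipartiteGraph,
    moduleDepth_quotient_edgeIdeal_completeBipartiteGraph, Nat.card_fin, Nat.card_fin,
    max_eq_left (by exact_mod_cast hnm)]
  have h2 : ((1 : ℕ∞) : WithBot ℕ∞) + 1 = ((2 : ℕ) : WithBot ℕ∞) := by norm_num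
  rw [h2, Nat.cast_le]
  exact ⟨fun h ↦ ⟨hnm, h⟩, fun h ↦ h.2⟩
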